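/- Let $N\ge 2$ be even. There is exactly one sequence $x_1>x_2>\dots>x_N$ of real numbers which is symmetric, i.e. $x_n=-x_{N+1-n}$ for $1\le n\le N$, and satisfies $$x_1+\dots+x_n\neq 0,\qquad x_{n+1}=x_n-\frac{1}{x_1+\dots+x_n}\qquad(1\le n\le N-1).$$ Let $\mathbb F_N=\frac1N\sum_{n=1}^N\delta_{x_n}$ be its empirical distribution, let $\mathbb F_\infty$ be the standard Gaussian distribution $\mathcal N(0,1)$ on $\mathbb R$, and let $$d_{\mathrm W}(\mu,\nu)=\sup\Big\{\Big|\int h\,d\mu-\int h\,d\nu\Big| : h\colon\mathbb R\to\mathbb R,\ \mathrm{Lip}(h)\le 1\Big\}$$ be the Wasserstein distance of probability measures with finite first moment. Then $d_{\mathrm W}(\mathbb F_N,\mathbb F_\infty)\asymp\sqrt{\log N}/N$ over the even integers $N\ge2$, that is, there are absolute constants $c,C>0$ such that $$c\,\frac{\sqrt{\log N}}{N}\ \le\ d_{\mathrm W}(\mathbb F_N,\mathbb F_\infty)\ \le\ C\,\frac{\sqrt{\log N}}{N}\qquad\text{for all even } N\ge 2 .$$ Moreover, for all even $N\ge 2$,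 $$d_{\mathrm W}(\mathbb F_N,\mathbb F_\infty)\le\frac{1+4x_1}{N},\qquad x_1\le A\sqrt{\log N},$$ with an absolute constant $A>0$. -/

import Mathlib

open MeasureTheory ProbabilityTheory
open scoped ENNReal NNReal

noncomputable section

/-- The Wasserstein (Kantorovich) distance `sup_h |∫ h dμ - ∫ h dν|`, where `h` ranges over the
`1`-Lipschitz functions. Both integrals are required to exist, which is automatic if `μ` and `ν`
have a finite first moment. The value is extended-real, so that the supremum is never junk. -/
def wassersteinDist {S : Type*} [PseudoMetricSpace S] [MeasurableSpace S] (μ ν : Measure S) :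
    ℝ≥0∞ :=
  ⨆ (h : S → ℝ) (_ : LipschitzWith 1 h) (_ : Integrable h μ) (_ : Integrable h ν),
    ENNReal.ofReal |∫ s, h s ∂μ - ∫ s, h s ∂ν|

/-- The empirical distribution of the points `x_1, …, x_N`: mass `1 / N` at each of them. -/
def empiricalDist {N : ℕ} (x : Fin N → ℝ) : Measure ℝ :=
  (N : ℝ≥0∞)⁻¹ • ∑ i, Measure.dirac (x i)

/-- `x_{n+1} = x_n - 1 / (x_1 + ⋯ + x_n)` for `1 ≤ n < N`, all denominators being nonzero.
The entry `x_n` is `x i` with `i = n - 1`. -/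
def SolvesRecursion {N : ℕ} (x : Fin N → ℝ) : Prop :=
  ∀ (i : Fin N) (hi : (i : ℕ) + 1 < N),
    ∑ j ∈ Finset.Iic i, x j ≠ 0 ∧
      x ⟨i + 1, hi⟩ = x i - 1 / ∑ j ∈ Finset.Iic i, x j

/-- Symmetric (`x_n = -x_{N+1-n}`), strictly decreasing solutions of the recursion. -/
structure IsGroundState {N : ℕ} (x : Fin N → ℝ) : Prop where
  recursion : SolvesRecursion x
  symmetric : ∀ i, x i = -x i.rev
  strictAnti : StrictAnti x

end

/-! With `S_k` the partial sums, the recursion says that consecutive points are `1 / S_k` apart. By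
symmetry the total sum vanishes, so summation by parts turns `∑ x_k f(x_k)` into the sum of the
difference quotients of `f` over the gaps (`sum_mul_eq`): a discrete form of the Gaussian identity
`E[X f(X)] = E[f'(X)]`.

Upper bound: let `f` solve Stein's equation for a 1-Lipschitz `h`. Since `f'` is 2-Lipschitz,
replacing each quotient by `f'` at an endpoint costs at most the gap, and the gaps add up to `2
x_1`. One unmatched value `f'(x_1)` remains, of size at most `1 + 2 x_1`.

Lower bound: a primitive `P` of the distance `d` to the points gives the test function `(d - t P) /
2`, of Gaussian mean zero. On the points `d` vanishes, and the quotients of `P` are at least gap /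
6, so the sum is at most `-x_1 / 6`.

Finally `(k + 1) x_k ≤ S_k ≤ (k + 1) x_1` (indices from 0) compares the gaps with the harmonic
series, so `x_1` has order `√(log N)`. Existence and uniqueness come from shooting in `x_1`, since
the recursion is strictly increasing in its start. -/

open Filter Topology Set

/-! ### Gaussian density and Mills ratio -/

/-- The standard Gaussian density satisfies `φ' = -x φ`. -/
lemma hasDerivAt_gaussianPDFReal_zero_one (x : ℝ) :
    HasDerivAt (gaussianPDFReal 0 1) (-x * gaussianPDFReal 0 1 x) x := by
  have h1 : HasDerivAt (fun y : ℝ => -(y - 0) ^ 2 / (2 * ((1 : ℝ≥0) : ℝ))) (-x) x := by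
    refine ((((hasDerivAt_id' x).sub_const 0).fun_pow 2).fun_neg.div_const
      (2 * ((1 : ℝ≥0) : ℝ))).congr_deriv ?_
    push_cast
    ring
  have h2 := (h1.exp).const_mul ((√(2 * Real.pi * ((1 : ℝ≥0) : ℝ)))⁻¹)
  rw [gaussianPDFReal_def]
  exact h2.congr_deriv (by ring)

lemma continuous_gaussianPDFReal_zero_one : Continuous (gaussianPDFReal 0 1) :=
  continuous_iff_continuousAt.2 fun x => (hasDerivAt_gaussianPDFReal_zero_one x).continuousAt

lemma integrable_mul_gaussianPDFReal {h : ℝ → ℝ} (hh : Integrable h (gaussianReal 0 1)) :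
    Integrable (fun t => h t * gaussianPDFReal 0 1 t) := by
  rw [gaussianReal_of_var_ne_zero 0 one_ne_zero] at hh
  rw [integrable_withDensity_iff_integrable_smul' (measurable_gaussianPDF 0 1)
    (ae_of_all _ fun _ => gaussianPDF_lt_top)] at hh
  refine hh.congr (ae_of_all _ fun x => ?_)
  simp [toReal_gaussianPDF, mul_comm]

lemma integral_gaussianReal_eq_integral_mul (h : ℝ → ℝ) :
    ∫ t, h t ∂(gaussianReal 0 1) = ∫ t, h t * gaussianPDFReal 0 1 t := by
  rw [integral_gaussianReal_eq_integral_smul one_ne_zero]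
  simp [mul_comm]

/-- Lower bound on the Mills ratio of the standard Gaussian. -/
lemma mul_gaussianPDFReal_le_integral_Ioi (x : ℝ) :
    x / (1 + x ^ 2) * gaussianPDFReal 0 1 x ≤ ∫ t in Ioi x, gaussianPDFReal 0 1 t := by
  set φ := gaussianPDFReal 0 1 with hφ
  have hpos : ∀ t, 0 ≤ φ t := gaussianPDFReal_nonneg 0 1
  have hint : Integrable φ := integrable_gaussianPDFReal 0 1
  -- Minus this derivative is at most `φ`; integrating over `(x, ∞)` gives the bound, for `x` of
  -- either sign.
  have hd : ∀ t, HasDerivAt (fun t => t / (1 + t ^ 2) * φ t)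
      (-((1 - 2 / (1 + t ^ 2) ^ 2) * φ t)) t := by
    intro t
    have h0 : (1 + t ^ 2) ≠ 0 := by positivity
    have h1 : HasDerivAt (fun t : ℝ => 1 + t ^ 2) (2 * t) t := by
      simpa using ((hasDerivAt_id' t).fun_pow 2).const_add 1
    refine (((hasDerivAt_id' t).fun_div h1 h0).fun_mul
      (hasDerivAt_gaussianPDFReal_zero_one t)).congr_deriv ?_
    simp only [← hφ]
    field_simp
    ring
  have hc : ∀ t : ℝ, ‖(1 - 2 / (1 + t ^ 2) ^ 2)‖ ≤ 1 := by
    intro t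
    have h1 : (1 : ℝ) ≤ (1 + t ^ 2) ^ 2 := by nlinarith [sq_nonneg t]
    have h2 : 2 / (1 + t ^ 2) ^ 2 ≤ 2 := by
      rw [div_le_iff₀ (by positivity)]; linarith
    have h3 : 0 ≤ 2 / (1 + t ^ 2) ^ 2 := by positivity
    rw [Real.norm_eq_abs, abs_le]; constructor <;> linarith
  have hi1 : Integrable (fun t => (1 - 2 / (1 + t ^ 2) ^ 2) * φ t) := by
    refine hint.bdd_mul (c := 1) ?_ (ae_of_all _ hc)
    refine Continuous.aestronglyMeasurable ?_
    refine continuous_const.sub (continuous_const.div (by fun_prop) fun t => ?_)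
    positivity
  have hi0 : Integrable (fun t => t / (1 + t ^ 2) * φ t) := by
    refine hint.bdd_mul (c := 1) ?_ (ae_of_all _ fun t => ?_)
    · refine Continuous.aestronglyMeasurable ?_
      refine continuous_id.div (by fun_prop) fun t => ?_
      positivity
    · have h0 : 0 < (1 + t ^ 2) := by positivity
      rw [Real.norm_eq_abs, abs_div, abs_of_pos h0, div_le_one h0, abs_le]
      constructor <;> nlinarith [sq_nonneg (t - 1), sq_nonneg (t + 1)]
  have ht : Tendsto (fun t => t / (1 + t ^ 2) * φ t) atTop (𝓝 0) :=
    tendsto_zero_of_hasDerivAt_of_integrableOn_Ioi (a := x) (fun t _ => hd t)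
      hi1.neg.integrableOn hi0.integrableOn
  have key := integral_Ioi_of_hasDerivAt_of_tendsto' (a := x) (fun t _ => hd t)
    hi1.neg.integrableOn ht
  rw [integral_neg] at key
  have : ∫ t in Ioi x, (1 - 2 / (1 + t ^ 2) ^ 2) * φ t ≤ ∫ t in Ioi x, φ t := by
    refine setIntegral_mono hi1.integrableOn hint.integrableOn fun t => ?_
    have h3 : 0 ≤ 2 / (1 + t ^ 2) ^ 2 := by positivity
    nlinarith [hpos t]
  linarith

lemma gaussianPDFReal_zero_one_neg (x : ℝ) :
    gaussianPDFReal 0 1 (-x) = gaussianPDFReal 0 1 x := by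
  simp [gaussianPDFReal_def]

lemma mul_gaussianPDFReal_le_integral_Iic (x : ℝ) :
    -x / (1 + x ^ 2) * gaussianPDFReal 0 1 x ≤ ∫ t in Iic x, gaussianPDFReal 0 1 t := by
  have h := mul_gaussianPDFReal_le_integral_Ioi (-x)
  rw [gaussianPDFReal_zero_one_neg, neg_sq, ← integral_comp_neg_Iic] at h
  simpa only [gaussianPDFReal_zero_one_neg] using h

/-! ### Stein's equation and regularity of its solution -/

/-- The solution `f` of Stein's equation `f' - x f = h - E h`. -/
noncomputable def steinSolution (h : ℝ → ℝ) (x : ℝ) : ℝ :=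
  (∫ t in Iic x, (h t - ∫ s, h s ∂(gaussianReal 0 1)) * gaussianPDFReal 0 1 t) /
    gaussianPDFReal 0 1 x

section SteinSolution

variable {h : ℝ → ℝ}

lemma integrable_sub_integral_mul (hi : Integrable h (gaussianReal 0 1)) :
    Integrable (fun t => (h t - ∫ s, h s ∂(gaussianReal 0 1)) * gaussianPDFReal 0 1 t) :=
  integrable_mul_gaussianPDFReal (hi.sub (integrable_const _))

/-- The integrand is centred, so the solution can be estimated from either tail. -/
lemma integral_Iic_eq_neg_integral_Ioi (hi : Integrable h (gaussianReal 0 1)) (x : ℝ) :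
    ∫ t in Iic x, (h t - ∫ s, h s ∂(gaussianReal 0 1)) * gaussianPDFReal 0 1 t =
      -∫ t in Ioi x, (h t - ∫ s, h s ∂(gaussianReal 0 1)) * gaussianPDFReal 0 1 t := by
  have h1 := integral_add_compl (measurableSet_Iic (a := x)) (integrable_sub_integral_mul hi)
  rw [← integral_gaussianReal_eq_integral_mul (fun t => h t - ∫ s, h s ∂(gaussianReal 0 1)),
    integral_sub hi (integrable_const _), compl_Iic] at h1
  simp at h1
  linarith

lemma hasDerivAt_steinSolution (hc : Continuous h) (hi : Integrable h (gaussianReal 0 1)) (x : ℝ) :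
    HasDerivAt (steinSolution h)
      (x * steinSolution h x + (h x - ∫ s, h s ∂(gaussianReal 0 1))) x := by
  have hI := integrable_sub_integral_mul hi
  set m := ∫ s, h s ∂(gaussianReal 0 1)
  have hcont : Continuous (fun t => (h t - m) * gaussianPDFReal 0 1 t) :=
    (hc.sub continuous_const).mul continuous_gaussianPDFReal_zero_one
  have hF : HasDerivAt (fun x => ∫ t in Iic x, (h t - m) * gaussianPDFReal 0 1 t)
      ((h x - m) * gaussianPDFReal 0 1 x) x := by
    have h1 : (fun x => ∫ t in Iic x, (h t - m) * gaussianPDFReal 0 1 t) = fun x =>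
        (∫ t in (0 : ℝ)..x, (h t - m) * gaussianPDFReal 0 1 t) +
          ∫ t in Iic (0 : ℝ), (h t - m) * gaussianPDFReal 0 1 t := by
      ext y
      rw [← intervalIntegral.integral_Iic_sub_Iic hI.integrableOn hI.integrableOn]
      ring
    rw [h1]
    exact (intervalIntegral.integral_hasDerivAt_right (hcont.intervalIntegrable _ _)
      hcont.stronglyMeasurable.stronglyMeasurableAtFilter hcont.continuousAt).add_const _
  have hp : gaussianPDFReal 0 1 x ≠ 0 := (gaussianPDFReal_pos 0 1 x one_ne_zero).ne'
  refine (hF.fun_div (hasDerivAt_gaussianPDFReal_zero_one x) hp).congr_deriv ?_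
  rw [steinSolution]
  field_simp
  ring

/-- By Stein's equation `(x f)' = (1 + x²) f + x (h - E h)`. Monotonicity of `h` bounds `f φ` above
by `h x - E h` times a Gaussian tail, with either tail available; the sign of `h x - E h` selects
the tail for which the Mills bound gives a nonpositive derivative. -/
lemma antitone_mul_steinSolution (hc : Continuous h) (hi : Integrable h (gaussianReal 0 1))
    (hm : Monotone h) : Antitone fun x => x * steinSolution h x := by
  have hI := integrable_sub_integral_mul hi
  have hd := hasDerivAt_steinSolution hc hi
  have hdu : ∀ x, HasDerivAt (fun x => x * steinSolution h x)
      (1 * steinSolution h x + x * (x * steinSolution h x +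
        (h x - ∫ s, h s ∂(gaussianReal 0 1)))) x := fun x => (hasDerivAt_id' x).fun_mul (hd x)
  have hφi : Integrable (gaussianPDFReal 0 1) := integrable_gaussianPDFReal 0 1
  refine antitone_of_hasDerivAt_nonpos hdu fun x => ?_
  have hE := integral_Iic_eq_neg_integral_Ioi hi x
  have hdef : steinSolution h x * gaussianPDFReal 0 1 x =
      ∫ t in Iic x, (h t - ∫ s, h s ∂(gaussianReal 0 1)) * gaussianPDFReal 0 1 t :=
    div_mul_cancel₀ _ (gaussianPDFReal_pos 0 1 x one_ne_zero).ne'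
  set m := ∫ s, h s ∂(gaussianReal 0 1)
  set f := steinSolution h x
  have hφ : 0 < gaussianPDFReal 0 1 x := gaussianPDFReal_pos 0 1 x one_ne_zero
  have hpos : 0 < 1 + x ^ 2 := by positivity
  have up : f * gaussianPDFReal 0 1 x ≤ -((h x - m) * ∫ t in Ioi x, gaussianPDFReal 0 1 t) := by
    rw [hdef, hE, ← integral_const_mul]
    refine neg_le_neg (setIntegral_mono_on (hφi.const_mul _).integrableOn hI.integrableOn
      measurableSet_Ioi fun t ht => ?_)
    have := hm (le_of_lt ht)
    exact mul_le_mul_of_nonneg_right (by linarith) (gaussianPDFReal_nonneg 0 1 t)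
  have lo : f * gaussianPDFReal 0 1 x ≤ (h x - m) * ∫ t in Iic x, gaussianPDFReal 0 1 t := by
    rw [hdef, ← integral_const_mul]
    refine setIntegral_mono_on hI.integrableOn (hφi.const_mul _).integrableOn
      measurableSet_Iic fun t ht => ?_
    have := hm ht
    exact mul_le_mul_of_nonneg_right (by linarith) (gaussianPDFReal_nonneg 0 1 t)
  have hA := mul_gaussianPDFReal_le_integral_Ioi x
  have hB := mul_gaussianPDFReal_le_integral_Iic x
  have hA0 : 0 ≤ ∫ t in Ioi x, gaussianPDFReal 0 1 t :=
    integral_nonneg fun t => gaussianPDFReal_nonneg 0 1 t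
  have hB0 : 0 ≤ ∫ t in Iic x, gaussianPDFReal 0 1 t :=
    integral_nonneg fun t => gaussianPDFReal_nonneg 0 1 t
  suffices f * (1 + x ^ 2) ≤ -(x * (h x - m)) by
    simp only [Pi.zero_apply]
    linarith
  rcases le_total 0 (h x - m) with hs | hs
  · have h1 := up.trans (neg_le_neg (mul_le_mul_of_nonneg_left hA hs))
    have h2 : f ≤ -((h x - m) * (x / (1 + x ^ 2))) := by
      refine le_of_mul_le_mul_right ?_ hφ
      linarith
    calc f * (1 + x ^ 2) ≤ -((h x - m) * (x / (1 + x ^ 2))) * (1 + x ^ 2) :=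
          mul_le_mul_of_nonneg_right h2 hpos.le
      _ = _ := by field_simp
  · have h1 := lo.trans (mul_le_mul_of_nonpos_left hB hs)
    have h2 : f ≤ (h x - m) * (-x / (1 + x ^ 2)) := by
      refine le_of_mul_le_mul_right ?_ hφ
      linarith
    calc f * (1 + x ^ 2) ≤ (h x - m) * (-x / (1 + x ^ 2)) * (1 + x ^ 2) :=
          mul_le_mul_of_nonneg_right h2 hpos.le
      _ = _ := by field_simp

end SteinSolution

lemma LipschitzWith.integrable_gaussianReal {h : ℝ → ℝ} {K : ℝ≥0} (hh : LipschitzWith K h) :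
    Integrable h (gaussianReal 0 1) := by
  have hid : Integrable (fun x : ℝ => x) (gaussianReal 0 1) :=
    memLp_one_iff_integrable.1 (memLp_id_gaussianReal 1)
  refine Integrable.mono' ((integrable_const |h 0|).add (hid.norm.const_mul (K : ℝ)))
    hh.continuous.aestronglyMeasurable (ae_of_all _ fun x => ?_)
  have h1 := hh.dist_le_mul x 0
  rw [Real.dist_eq, Real.dist_eq, sub_zero] at h1
  have h2 := abs_add_le (h x - h 0) (h 0)
  rw [sub_add_cancel] at h2
  simp only [Pi.add_apply, Real.norm_eq_abs]
  linarith

lemma steinSolution_linear_combination {h : ℝ → ℝ} (hi : Integrable h (gaussianReal 0 1))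
    (c : ℝ) (x : ℝ) : steinSolution (fun t => t + c * h t) x = -1 + c * steinSolution h x := by
  have hid : Integrable (fun x : ℝ => x) (gaussianReal 0 1) :=
    memLp_one_iff_integrable.1 (memLp_id_gaussianReal 1)
  have hφ : gaussianPDFReal 0 1 x ≠ 0 := (gaussianPDFReal_pos 0 1 x one_ne_zero).ne'
  have hid' : Integrable (fun t => t * gaussianPDFReal 0 1 t) := integrable_mul_gaussianPDFReal hid
  have h1 : ∫ t in Iic x, t * gaussianPDFReal 0 1 t = -gaussianPDFReal 0 1 x := by
    have hd : ∀ t, HasDerivAt (fun t => -gaussianPDFReal 0 1 t) (t * gaussianPDFReal 0 1 t) t :=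
      fun t => by simpa using (hasDerivAt_gaussianPDFReal_zero_one t).fun_neg
    have ht : Tendsto (fun t => -gaussianPDFReal 0 1 t) atBot (𝓝 0) :=
      tendsto_zero_of_hasDerivAt_of_integrableOn_Iic (a := x) (fun t _ => hd t)
        hid'.integrableOn (integrable_gaussianPDFReal 0 1).neg.integrableOn
    rw [integral_Iic_of_hasDerivAt_of_tendsto' (fun t _ => hd t) hid'.integrableOn ht]
    simp
  unfold steinSolution
  rw [integral_add hid (hi.const_mul c), integral_const_mul, integral_id_gaussianReal]
  have h2 : ∀ t, (t + c * h t - (0 + c * ∫ s, h s ∂(gaussianReal 0 1))) * gaussianPDFReal 0 1 t =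
      t * gaussianPDFReal 0 1 t +
        c * ((h t - ∫ s, h s ∂(gaussianReal 0 1)) * gaussianPDFReal 0 1 t) := fun t => by ring
  simp_rw [h2]
  rw [integral_add hid'.integrableOn ((integrable_sub_integral_mul hi).const_mul c).integrableOn,
    integral_const_mul, h1]
  field_simp

/-- For `1`-Lipschitz `h`, the function `x f` is `1`-Lipschitz. -/
lemma abs_mul_steinSolution_sub_le {h : ℝ → ℝ} (hh : LipschitzWith 1 h) (x y : ℝ) :
    |x * steinSolution h x - y * steinSolution h y| ≤ |x - y| := by
  have hi := hh.integrable_gaussianReal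
  have hid : Integrable (fun x : ℝ => x) (gaussianReal 0 1) :=
    memLp_one_iff_integrable.1 (memLp_id_gaussianReal 1)
  -- `t + c h(t)` is monotone, and `f` depends linearly on `h`, with `-1` the solution for the
  -- identity. So `x (-1 + c f)` is antitone; `c = ±1` gives the two sides of the Lipschitz bound.
  have key : ∀ c : ℝ, |c| ≤ 1 → ∀ u v : ℝ, u ≤ v →
      v * (-1 + c * steinSolution h v) ≤ u * (-1 + c * steinSolution h u) := by
    intro c hc u v huv
    have hmono : Monotone fun t => t + c * h t := by
      intro a b hab
      have h1 := hh.dist_le_mul a b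
      rw [Real.dist_eq, Real.dist_eq, abs_of_nonpos (sub_nonpos.2 hab)] at h1
      have h2 : |c * (h a - h b)| ≤ 1 * (-(a - b)) := by
        rw [abs_mul]
        exact mul_le_mul hc (by simpa using h1) (abs_nonneg _) zero_le_one
      have h3 := le_abs_self (c * (h a - h b))
      simp only
      linarith
    have := antitone_mul_steinSolution (h := fun t => t + c * h t)
      (continuous_id.add (continuous_const.mul hh.continuous)) (hid.add (hi.const_mul c)) hmono huv
    simpa only [steinSolution_linear_combination hi] using this
  wlog hxy : x ≤ y generalizing x y
  · rw [abs_sub_comm, abs_sub_comm x]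
    exact this y x (le_of_not_ge hxy)
  have h1 := key 1 (by simp) x y hxy
  have h2 := key (-1) (by simp) x y hxy
  rw [abs_of_nonpos (sub_nonpos.2 hxy), abs_le]
  constructor <;> linarith

/-- The derivative of the Stein solution, as given by Stein's equation. -/
noncomputable def steinDeriv (h : ℝ → ℝ) (x : ℝ) : ℝ :=
  x * steinSolution h x + (h x - ∫ s, h s ∂(gaussianReal 0 1))

lemma abs_steinDeriv_sub_le {h : ℝ → ℝ} (hh : LipschitzWith 1 h) (x y : ℝ) :
    |steinDeriv h x - steinDeriv h y| ≤ 2 * |x - y| := by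
  have h1 := abs_mul_steinSolution_sub_le hh x y
  have h2 := hh.dist_le_mul x y
  rw [Real.dist_eq, Real.dist_eq] at h2
  have h3 := abs_add_le (x * steinSolution h x - y * steinSolution h y) (h x - h y)
  have h4 : steinDeriv h x - steinDeriv h y =
      (x * steinSolution h x - y * steinSolution h y) + (h x - h y) := by
    unfold steinDeriv; ring
  rw [h4]
  simp only [NNReal.coe_one, one_mul] at h2
  linarith

lemma abs_steinDeriv_zero_le {h : ℝ → ℝ} (hh : LipschitzWith 1 h) : |steinDeriv h 0| ≤ 1 := by
  have hi := hh.integrable_gaussianReal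
  have hsq : Integrable (fun x : ℝ => x ^ 2) (gaussianReal 0 1) :=
    (memLp_id_gaussianReal 2).integrable_sq
  have hvar : ∫ x, x ^ 2 ∂(gaussianReal 0 1) = 1 := by
    have := variance_fun_id_gaussianReal (μ := 0) (v := 1)
    rw [variance_eq_integral (by fun_prop)] at this
    simpa using this
  have h1 : steinDeriv h 0 = ∫ s, (h 0 - h s) ∂(gaussianReal 0 1) := by
    rw [integral_sub (integrable_const _) hi]
    simp [steinDeriv]
  -- The value at 0 is `h 0 - E h`, and `|h 0 - h s| ≤ |s| ≤ (1 + s²) / 2`, whose mean is 1.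
  have h2 : ∫ s, (1 + s ^ 2) / 2 ∂(gaussianReal 0 1) = 1 := by
    rw [integral_div, integral_add (integrable_const _) hsq, hvar]
    norm_num
  rw [h1, ← h2, ← Real.norm_eq_abs]
  refine norm_integral_le_of_norm_le (((integrable_const _).add hsq).div_const 2)
    (ae_of_all _ fun s => ?_)
  have h3 := hh.dist_le_mul 0 s
  rw [Real.dist_eq, Real.dist_eq] at h3
  simp only [NNReal.coe_one, one_mul, zero_sub, abs_neg] at h3
  rw [Real.norm_eq_abs]
  nlinarith [sq_nonneg (|s| - 1), sq_abs s]

/-- Second-order Taylor estimate for the Stein solution. -/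
lemma abs_steinSolution_slope_sub_le {h : ℝ → ℝ} (hh : LipschitzWith 1 h) {x y : ℝ}
    (hxy : y < x) :
    |(steinSolution h x - steinSolution h y) / (x - y) - steinDeriv h y| ≤ x - y := by
  have hd := hasDerivAt_steinSolution hh.continuous hh.integrable_gaussianReal
  have hpos : 0 < x - y := sub_pos.2 hxy
  -- The expression vanishes for `x = y` and has nonpositive derivative in `x` beyond `y`, because
  -- `f'` is 2-Lipschitz. Both signs of `c` are needed.
  have key : ∀ c : ℝ, |c| ≤ 1 → c * (steinSolution h x - steinSolution h y) -
      c * steinDeriv h y * (x - y) - (x - y) ^ 2 ≤ 0 := by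
    intro c hc
    have hg : ∀ t, HasDerivAt
        (fun t => c * steinSolution h t - c * steinDeriv h y * (t - y) - (t - y) ^ 2)
        (c * steinDeriv h t - c * steinDeriv h y - 2 * (t - y)) t := fun t => by
      refine ((((hd t).const_mul c).fun_sub (((hasDerivAt_id' t).sub_const y).const_mul
        (c * steinDeriv h y))).fun_sub (((hasDerivAt_id' t).sub_const y).fun_pow 2)).congr_deriv ?_
      simp only [steinDeriv]
      ring
    obtain ⟨s, hs, hs'⟩ := exists_hasDerivAt_eq_slope _ _ hxy
      (fun t _ => (hg t).continuousAt.continuousWithinAt) (fun t _ => hg t)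
    have h1 : |c * (steinDeriv h s - steinDeriv h y)| ≤ 1 * (2 * |s - y|) := by
      rw [abs_mul]
      exact mul_le_mul hc (abs_steinDeriv_sub_le hh s y) (abs_nonneg _) zero_le_one
    rw [abs_of_pos (sub_pos.2 hs.1)] at h1
    have h2 := le_abs_self (c * (steinDeriv h s - steinDeriv h y))
    rw [eq_div_iff hpos.ne'] at hs'
    nlinarith
  have h1 := key 1 (by simp)
  have h2 := key (-1) (by simp)
  have h3 : (steinSolution h x - steinSolution h y) / (x - y) - steinDeriv h y =
      (steinSolution h x - steinSolution h y - steinDeriv h y * (x - y)) / (x - y) := by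
    field_simp
  rw [h3, abs_div, abs_of_pos hpos, div_le_iff₀ hpos, abs_le]
  constructor <;> nlinarith

/-! ### The recursion as a function of its starting point -/

/-- The pair (`x_{k+1}`, `x_1 + ⋯ + x_{k+1}`) produced by the recursion started at `x_1 = a`. -/
noncomputable def shoot (a : ℝ) : ℕ → ℝ × ℝ
  | 0 => (a, a)
  | k + 1 => ((shoot a k).1 - 1 / (shoot a k).2,
      (shoot a k).2 + ((shoot a k).1 - 1 / (shoot a k).2))

/-- The points of the recursion started at `a`. -/
noncomputable def shootVal (a : ℝ) (k : ℕ) : ℝ := (shoot a k).1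

/-- The partial sums of the recursion started at `a`. -/
noncomputable def shootSum (a : ℝ) (k : ℕ) : ℝ := (shoot a k).2

@[simp] lemma shootVal_zero (a : ℝ) : shootVal a 0 = a := rfl

@[simp] lemma shootSum_zero (a : ℝ) : shootSum a 0 = a := rfl

lemma shootVal_succ (a : ℝ) (k : ℕ) :
    shootVal a (k + 1) = shootVal a k - 1 / shootSum a k := rfl

lemma shootSum_succ (a : ℝ) (k : ℕ) :
    shootSum a (k + 1) = shootSum a k + shootVal a (k + 1) := rfl

lemma shootSum_pos_of_shootVal_pos {a : ℝ} {n : ℕ} (h : ∀ k ≤ n, 0 < shootVal a k) :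
    ∀ k ≤ n, 0 < shootSum a k := by
  intro k hk
  induction k with
  | zero => exact h 0 hk
  | succ k ih =>
    rw [shootSum_succ]
    exact add_pos (ih (by omega)) (h _ hk)

/-- Both components of the recursion increase strictly with the starting point. -/
lemma shoot_lt_shoot {a b : ℝ} (hab : a < b) {n : ℕ} (h : ∀ k < n, 0 < shootSum a k) :
    ∀ k ≤ n, shootVal a k < shootVal b k ∧ shootSum a k < shootSum b k := by
  intro k hk
  induction k with
  | zero => exact ⟨hab, hab⟩
  | succ k ih =>
    obtain ⟨h1, h2⟩ := ih (by omega)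
    have h3 : 1 / shootSum b k < 1 / shootSum a k :=
      one_div_lt_one_div_of_lt (h k (by omega)) h2
    have h4 : shootVal a (k + 1) < shootVal b (k + 1) := by
      rw [shootVal_succ, shootVal_succ]
      linarith
    refine ⟨h4, ?_⟩
    rw [shootSum_succ, shootSum_succ]
    linarith

lemma continuousOn_shoot {s : Set ℝ} {n : ℕ} (h : ∀ b ∈ s, ∀ k < n, 0 < shootSum b k) :
    ∀ k ≤ n, ContinuousOn (fun b => shootVal b k) s ∧ ContinuousOn (fun b => shootSum b k) s := by
  intro k hk
  induction k with
  | zero => exact ⟨continuousOn_id, continuousOn_id⟩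
  | succ k ih =>
    obtain ⟨h1, h2⟩ := ih (by omega)
    have h3 : ContinuousOn (fun b => shootVal b (k + 1)) s := by
      simp only [shootVal_succ]
      exact h1.sub (continuousOn_const.div h2 fun b hb => (h b hb k (by omega)).ne')
    refine ⟨h3, ?_⟩
    simp only [shootSum_succ]
    exact h2.add h3

/-- Sums that stay at least 1 allow steps of at most 1. This supplies the right endpoint for the
intermediate value arguments. -/
lemma sub_le_shootVal {b : ℝ} {n : ℕ} (hb : (n : ℝ) + 1 ≤ b) :
    ∀ k ≤ n, b - k ≤ shootVal b k ∧ b ≤ shootSum b k := by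
  intro k hk
  induction k with
  | zero => simp
  | succ k ih =>
    obtain ⟨h1, h2⟩ := ih (by omega)
    have h0 : (k : ℝ) + 1 ≤ n := by exact_mod_cast hk
    have hk0 : (0 : ℝ) ≤ k := k.cast_nonneg
    have h3 : 1 / shootSum b k ≤ 1 := by
      rw [div_le_one (by linarith)]
      linarith
    have h4 : b - ((k + 1 : ℕ) : ℝ) ≤ shootVal b (k + 1) := by
      rw [shootVal_succ]
      push_cast
      linarith
    refine ⟨h4, ?_⟩
    rw [shootSum_succ]
    push_cast at h4
    linarith

/-! ### Existence, uniqueness and symmetry of balanced starts -/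

/-- `a` is the first point of a symmetric solution with `2 (n + 1)` points. -/
structure IsBalanced (n : ℕ) (a : ℝ) : Prop where
  pos : ∀ k ≤ n, 0 < shootVal a k
  middle : shootVal a n + shootVal a (n + 1) = 0

/-- Induction on `n`, raising the start twice: from the balanced `a` to `b` with `x_{n+1} = 0`, then
to `c` with `x_{n+1} + x_{n+2} = 0`. Monotonicity in the start keeps all earlier values positive. -/
lemma exists_isBalanced (n : ℕ) : ∃ a, IsBalanced n a := by
  induction n with
  | zero =>
    have h2 : 0 < √(2 : ℝ) := by positivity
    refine ⟨1 / √2, fun k hk => ?_, ?_⟩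
    · obtain rfl : k = 0 := by omega
      simp
    · simp only [shootVal_succ, shootVal_zero, shootSum_zero]
      field_simp
      norm_num
  | succ n ih =>
    obtain ⟨a, ha⟩ := ih
    have hSa := shootSum_pos_of_shootVal_pos ha.pos
    have hval : ∀ b ∈ Ici a, ∀ k ≤ n, 0 < shootVal b k := by
      intro b hb k hk
      rcases eq_or_lt_of_le (mem_Ici.1 hb) with rfl | h
      · exact ha.pos k hk
      · exact (ha.pos k hk).trans (shoot_lt_shoot h (fun k hk => hSa k (by omega)) k hk).1
    have hS : ∀ b ∈ Ici a, ∀ k ≤ n, 0 < shootSum b k := fun b hb =>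
      shootSum_pos_of_shootVal_pos (hval b hb)
    -- At `a` the value is `-x_n < 0`, and for large starts it is positive. From `b` onwards the sum
    -- `S_{n+1}` is positive, so `x_{n+2}` depends continuously on the start.
    obtain ⟨b, hb, hb0⟩ : ∃ b ∈ Ici a, shootVal b (n + 1) = 0 := by
      have hc := (continuousOn_shoot (n := n + 1) (fun b hb k hk => hS b hb k (by omega))
        (n + 1) le_rfl).1
      set B := max a ((n : ℝ) + 2)
      have hB := (sub_le_shootVal (n := n + 1) (b := B) (by
        push_cast; linarith [le_max_right a ((n : ℝ) + 2)]) (n + 1) le_rfl).1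
      have h0 : (0 : ℝ) ∈ Icc (shootVal a (n + 1)) (shootVal B (n + 1)) := by
        constructor
        · linarith [ha.middle, ha.pos n le_rfl]
        · push_cast at hB
          linarith [le_max_right a ((n : ℝ) + 2)]
      obtain ⟨b, hb, hb0⟩ := intermediate_value_Icc (le_max_left _ _)
        (hc.mono Icc_subset_Ici_self) h0
      exact ⟨b, hb.1, hb0⟩
    have hab : a ≤ b := hb
    have hval' : ∀ c ∈ Ici b, 0 ≤ shootVal c (n + 1) := by
      intro c hc
      rcases eq_or_lt_of_le (mem_Ici.1 hc) with rfl | h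
      · exact hb0.ge
      · rw [← hb0]
        exact (shoot_lt_shoot h (fun k hk => hS b hb k (by omega)) (n + 1) le_rfl).1.le
    have hS' : ∀ c ∈ Ici b, ∀ k < n + 2, 0 < shootSum c k := by
      intro c hc k hk
      have hca : c ∈ Ici a := hab.trans hc
      rcases Nat.lt_succ_iff_lt_or_eq.1 hk with h | rfl
      · exact hS c hca k (by omega)
      · rw [shootSum_succ]
        exact add_pos_of_pos_of_nonneg (hS c hca n le_rfl) (hval' c hc)
    have hneg : shootVal b (n + 1) + shootVal b (n + 2) < 0 := by
      rw [shootVal_succ b (n + 1), hb0]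
      have : 0 < 1 / shootSum b (n + 1) := one_div_pos.2 (hS' b self_mem_Ici _ (by omega))
      linarith
    obtain ⟨c, hc, hc0⟩ : ∃ c ∈ Ici b, shootVal c (n + 1) + shootVal c (n + 2) = 0 := by
      have hc := ((continuousOn_shoot hS' (n + 1) (by omega)).1).add
        (continuousOn_shoot hS' (n + 2) le_rfl).1
      set B := max b ((n : ℝ) + 3)
      have hB := sub_le_shootVal (n := n + 2) (b := B) (by
        push_cast; linarith [le_max_right b ((n : ℝ) + 3)])
      have hB1 := (hB (n + 1) (by omega)).1
      have hB2 := (hB (n + 2) le_rfl).1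
      have h0 : (0 : ℝ) ∈ Icc (shootVal b (n + 1) + shootVal b (n + 2))
          (shootVal B (n + 1) + shootVal B (n + 2)) := by
        refine ⟨hneg.le, ?_⟩
        push_cast at hB1 hB2
        linarith [le_max_right b ((n : ℝ) + 3)]
      obtain ⟨c, hc, hc0⟩ := intermediate_value_Icc (le_max_left _ _)
        (hc.mono Icc_subset_Ici_self) h0
      exact ⟨c, hc.1, hc0⟩
    have hbc : b < c := lt_of_le_of_ne hc (by rintro rfl; exact hneg.ne hc0)
    refine ⟨c, fun k hk => ?_, hc0⟩
    rcases Nat.lt_succ_iff_lt_or_eq.1 (Nat.lt_succ_of_le hk) with h | rfl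
    · exact hval c (hab.trans hc) k (by omega)
    · rw [← hb0]
      exact (shoot_lt_shoot hbc (fun k hk => hS b hb k (by omega)) (n + 1) le_rfl).1

namespace IsBalanced

variable {n : ℕ} {a b : ℝ}

/-- A larger start strictly increases both middle values, so their sum vanishes at most once. -/
protected lemma unique (ha : IsBalanced n a) (hb : IsBalanced n b) : a = b := by
  have key : ∀ {a b : ℝ}, IsBalanced n a → IsBalanced n b → ¬ a < b := by
    intro a b ha hb h
    have hS := shootSum_pos_of_shootVal_pos ha.pos
    have h1 := shoot_lt_shoot (n := n + 1) h fun k hk => hS k (by omega)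
    linarith [(h1 n (by omega)).1, (h1 (n + 1) le_rfl).1, ha.middle, hb.middle]
  exact le_antisymm (not_lt.1 (key hb ha)) (not_lt.1 (key ha hb))

lemma start_pos (ha : IsBalanced n a) : 0 < a := ha.pos 0 (by omega)

/-- The recursion is reversible: the middle condition alone propagates outwards, reflecting values
with a sign and sums without. -/
lemma symm_aux (ha : IsBalanced n a) (j : ℕ) (hj : j ≤ n) :
    shootVal a (n + 1 + j) = -shootVal a (n - j) ∧
      shootSum a (n + j) = shootSum a (n - j) := by
  induction j with
  | zero => exact ⟨by simp only [add_zero, Nat.sub_zero]; linarith [ha.middle], rfl⟩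
  | succ j ih =>
    obtain ⟨h1, h2⟩ := ih (by omega)
    obtain ⟨i, hi⟩ : ∃ i, n - j = i + 1 := ⟨n - j - 1, by omega⟩
    have hi' : n - (j + 1) = i := by omega
    rw [hi'] at *
    rw [hi] at h1 h2
    have h3 : shootSum a (n + (j + 1)) = shootSum a i := by
      rw [← add_assoc, shootSum_succ, h2, shootSum_succ, show n + j + 1 = n + 1 + j by omega, h1]
      ring
    refine ⟨?_, h3⟩
    rw [← add_assoc, shootVal_succ, h1, show n + 1 + j = n + (j + 1) by omega, h3,
      shootVal_succ]
    ring

lemma symm (ha : IsBalanced n a) {k : ℕ} (hk : k ≤ 2 * n + 1) :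
    shootVal a k = -shootVal a (2 * n + 1 - k) := by
  rcases le_total k n with h | h
  · have := (ha.symm_aux (n - k) (by omega)).1
    rw [show n + 1 + (n - k) = 2 * n + 1 - k by omega, show n - (n - k) = k by omega] at this
    rw [this, neg_neg]
  · rcases eq_or_lt_of_le h with rfl | h
    · have := (ha.symm_aux 0 (by omega)).1
      rw [show 2 * n + 1 - n = n + 1 + 0 by omega, this]
      simp
    · have := (ha.symm_aux (k - n - 1) (by omega)).1
      rw [show n + 1 + (k - n - 1) = k by omega,
        show n - (k - n - 1) = 2 * n + 1 - k by omega] at this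
      exact this

lemma start_le_shootSum (ha : IsBalanced n a) {k : ℕ} (hk : k ≤ 2 * n) : a ≤ shootSum a k := by
  have h1 : ∀ k ≤ n, a ≤ shootSum a k := by
    intro k hk
    induction k with
    | zero => simp
    | succ k ih =>
      rw [shootSum_succ]
      linarith [ih (by omega), ha.pos (k + 1) hk]
  rcases le_total k n with h | h
  · exact h1 k h
  · have := (ha.symm_aux (k - n) (by omega)).2
    rw [show n + (k - n) = k by omega] at this
    rw [this]
    exact h1 _ (by omega)

lemma shootSum_pos (ha : IsBalanced n a) {k : ℕ} (hk : k ≤ 2 * n) : 0 < shootSum a k :=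
  ha.start_pos.trans_le (ha.start_le_shootSum hk)

lemma shootSum_last (ha : IsBalanced n a) : shootSum a (2 * n + 1) = 0 := by
  obtain ⟨h1, h2⟩ := ha.symm_aux n le_rfl
  rw [shootSum_succ, show 2 * n = n + n by omega, h2, show n + n + 1 = n + 1 + n by omega, h1]
  simp

lemma shootVal_last (ha : IsBalanced n a) : shootVal a (2 * n + 1) = -a := by
  rw [ha.symm le_rfl]
  simp

lemma shootVal_lt (ha : IsBalanced n a) {i j : ℕ} (hij : i < j) (hj : j ≤ 2 * n + 1) :
    shootVal a j < shootVal a i := by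
  induction j, hij using Nat.le_induction with
  | base =>
    rw [shootVal_succ]
    linarith [one_div_pos.2 (ha.shootSum_pos (k := i) (by omega))]
  | succ j hij ih =>
    rw [shootVal_succ]
    linarith [one_div_pos.2 (ha.shootSum_pos (k := j) (by omega)), ih (by omega)]

lemma shootVal_le (ha : IsBalanced n a) {i j : ℕ} (hij : i ≤ j) (hj : j ≤ 2 * n + 1) :
    shootVal a j ≤ shootVal a i := by
  rcases eq_or_lt_of_le hij with rfl | h
  · exact le_rfl
  · exact (ha.shootVal_lt h hj).le

lemma gap (k : ℕ) : shootVal a k - shootVal a (k + 1) = 1 / shootSum a k := by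
  rw [shootVal_succ]
  ring

/-! ### Discrete Stein identity and growth of the first point -/

/-- Summation by parts along the recursion. -/
lemma sum_mul_eq (ha : IsBalanced n a) (f : ℝ → ℝ) :
    ∑ k ∈ Finset.range (2 * n + 2), shootVal a k * f (shootVal a k) =
      ∑ k ∈ Finset.range (2 * n + 1), (f (shootVal a k) - f (shootVal a (k + 1))) /
        (shootVal a k - shootVal a (k + 1)) := by
  have h1 : ∀ M, ∑ k ∈ Finset.range (M + 1), shootVal a k * f (shootVal a k) =
      shootSum a M * f (shootVal a M) +
        ∑ k ∈ Finset.range M, shootSum a k * (f (shootVal a k) - f (shootVal a (k + 1))) := by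
    intro M
    induction M with
    | zero => simp
    | succ M ih =>
      rw [Finset.sum_range_succ, ih, Finset.sum_range_succ, shootSum_succ]
      ring
  -- The boundary term drops out because the total sum is zero; each remaining `S_k` is the
  -- reciprocal of a gap.
  rw [h1, ha.shootSum_last, zero_mul, zero_add]
  refine Finset.sum_congr rfl fun k hk => ?_
  rw [Finset.mem_range] at hk
  rw [gap, div_div_eq_mul_div, div_one, mul_comm]

lemma sum_gap (ha : IsBalanced n a) :
    ∑ k ∈ Finset.range (2 * n + 1), (shootVal a k - shootVal a (k + 1)) = 2 * a := by
  rw [Finset.sum_range_sub', ha.shootVal_last, shootVal_zero]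
  ring

lemma shootSum_le (ha : IsBalanced n a) {k : ℕ} (hk : k ≤ 2 * n + 1) :
    shootSum a k ≤ (k + 1) * a := by
  induction k with
  | zero => simp
  | succ k ih =>
    have := ha.shootVal_le (Nat.zero_le (k + 1)) hk
    rw [shootVal_zero] at this
    rw [shootSum_succ]
    push_cast
    linarith [ih (by omega)]

lemma mul_shootVal_le_shootSum (ha : IsBalanced n a) {k : ℕ} (hk : k ≤ 2 * n + 1) :
    (k + 1) * shootVal a k ≤ shootSum a k := by
  induction k with
  | zero => simp
  | succ k ih =>
    have h1 := ha.shootVal_le (Nat.le_succ k) hk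
    have h2 := ih (by omega)
    rw [shootSum_succ]
    push_cast
    nlinarith

/-- Since `S_k ≤ (k + 1) a`, each gap is at least `1 / ((k + 1) a)`, while the gaps add up to `2 a`.
-/
lemma log_le_sq (ha : IsBalanced n a) : Real.log ((2 * n + 2 : ℕ) : ℝ) ≤ 2 * a ^ 2 := by
  have h1 := log_add_one_le_harmonic (2 * n + 1)
  have h2 : ((harmonic (2 * n + 1) : ℚ) : ℝ) ≤ a * (2 * a) := by
    rw [← ha.sum_gap, harmonic, Finset.mul_sum]
    push_cast
    refine Finset.sum_le_sum fun k hk => ?_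
    rw [Finset.mem_range] at hk
    have hS := ha.shootSum_pos (k := k) (by omega)
    rw [gap, mul_one_div, le_div_iff₀ hS, inv_mul_le_iff₀ (by positivity)]
    exact ha.shootSum_le (by omega)
  refine (le_trans (le_of_eq ?_) h1).trans (h2.trans (by linarith))
  push_cast
  ring_nf

/-- Telescoping over the positive half: `x_k² - x_{k+1}² ≤ 2 x_k (x_k - x_{k+1}) = 2 x_k / S_k ≤ 2 /
(k + 1)`. -/
lemma sq_le_log (ha : IsBalanced n a) :
    a ^ 2 ≤ 3 + 2 * Real.log ((2 * n + 2 : ℕ) : ℝ) := by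
  have h1 : ∀ k ≤ n, a ^ 2 - shootVal a k ^ 2 ≤ 2 * ((harmonic k : ℚ) : ℝ) := by
    intro k hk
    induction k with
    | zero => simp
    | succ k ih =>
      have hS := ha.shootSum_pos (k := k) (by omega)
      have h2 := ha.mul_shootVal_le_shootSum (k := k) (by omega)
      have h3 := ha.shootVal_lt (Nat.lt_succ_self k) (by omega)
      have h4 := ha.pos (k + 1) hk
      have h5 : shootVal a k * (shootVal a k - shootVal a (k + 1)) ≤ ((k : ℝ) + 1)⁻¹ := by
        rw [gap, mul_one_div, div_le_iff₀ hS, inv_mul_eq_div, le_div_iff₀ (by positivity)]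
        linarith
      rw [harmonic_succ]
      push_cast
      have := ih (by omega)
      nlinarith
  have h2 := h1 n le_rfl
  have h3 := harmonic_le_one_add_log n
  have hn := ha.pos n le_rfl
  have hS := ha.shootSum_pos (k := n) (by omega)
  -- The middle gap is `2 x_n = 1 / S_n`, and `x_n ≤ S_n`.
  have h4 : shootVal a n * (2 * shootVal a n) ≤ 1 := by
    have hg := gap (a := a) n
    have : 2 * shootVal a n = 1 / shootSum a n := by linarith [ha.middle]
    rw [this, mul_one_div, div_le_one hS]
    have h5 := ha.mul_shootVal_le_shootSum (k := n) (by omega)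
    nlinarith [(n.cast_nonneg : (0 : ℝ) ≤ n)]
  have h5 : Real.log n ≤ Real.log ((2 * n + 2 : ℕ) : ℝ) := by
    rcases Nat.eq_zero_or_pos n with rfl | hn0
    · simpa using Real.log_nonneg (by norm_num)
    · exact Real.log_le_log (by exact_mod_cast hn0) (by exact_mod_cast (by omega))
  nlinarith

lemma start_le_sqrt_log (ha : IsBalanced n a) :
    a ≤ 3 * √(Real.log ((2 * n + 2 : ℕ) : ℝ)) := by
  have h1 := ha.sq_le_log
  have h2 : Real.log 2 ≤ Real.log ((2 * n + 2 : ℕ) : ℝ) :=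
    Real.log_le_log (by norm_num) (by push_cast; linarith [(n.cast_nonneg : (0 : ℝ) ≤ n)])
  have h3 := Real.log_two_gt_d9
  -- It remains that `3 + 2 log N ≤ 9 log N`, which holds since `7 log 2 > 3`.
  refine le_of_sq_le_sq ?_ (by positivity)
  rw [mul_pow, Real.sq_sqrt (by linarith)]
  linarith

lemma sqrt_log_le_start (ha : IsBalanced n a) :
    √(Real.log ((2 * n + 2 : ℕ) : ℝ)) ≤ 2 * a := by
  refine Real.sqrt_le_iff.2 ⟨by linarith [ha.start_pos], ?_⟩
  have := ha.log_le_sq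
  nlinarith [sq_nonneg a]

end IsBalanced

/-! ### Ground states correspond to balanced starts -/

lemma sum_Iic_eq_shootSum {N : ℕ} {x : Fin N → ℝ} {a : ℝ}
    (h : ∀ k (hk : k < N), x ⟨k, hk⟩ = shootVal a k) :
    ∀ k (hk : k < N), ∑ j ∈ Finset.Iic (⟨k, hk⟩ : Fin N), x j = shootSum a k := by
  intro k hk
  induction k with
  | zero =>
    have : Finset.Iic (⟨0, hk⟩ : Fin N) = {⟨0, hk⟩} := by
      ext j
      simp [Fin.le_def, Fin.ext_iff]
    rw [this, Finset.sum_singleton, h, shootVal_zero, shootSum_zero]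
  | succ k ih =>
    have : Finset.Iic (⟨k + 1, hk⟩ : Fin N) =
        insert ⟨k + 1, hk⟩ (Finset.Iic ⟨k, by omega⟩) := by
      ext j
      simp only [Finset.mem_Iic, Finset.mem_insert, Fin.le_def, Fin.ext_iff]
      omega
    rw [this, Finset.sum_insert (by simp [Fin.le_def]), ih, h, shootSum_succ, add_comm]

lemma SolvesRecursion.eq_shootVal {N : ℕ} {x : Fin N → ℝ} (hx : SolvesRecursion x)
    (hN : 0 < N) : ∀ k (hk : k < N), x ⟨k, hk⟩ = shootVal (x ⟨0, hN⟩) k := by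
  intro k
  induction k using Nat.strong_induction_on with
  | _ k ih =>
    intro hk
    rcases k with _ | k
    · rfl
    · have h1 : ∑ j ∈ Finset.Iic (⟨k, by omega⟩ : Fin N), x j = shootSum (x ⟨0, hN⟩) k := by
        -- Truncation to the first `k + 1` points, the only ones covered by the induction
        -- hypothesis. In the bijection below, `min j k` equals `j` and only serves to prove the
        -- bound.
        have key := sum_Iic_eq_shootSum (N := k + 1)
          (x := fun i => x ⟨i, i.2.trans hk⟩) (a := x ⟨0, hN⟩)
          (fun i hi => ih i hi _) k (Nat.lt_succ_self k)
        rw [← key]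
        refine Finset.sum_bij' (fun j _ => ⟨min j k, by omega⟩) (fun j _ => ⟨j, j.2.trans hk⟩)
          ?_ ?_ ?_ ?_ ?_ <;> intro j hj <;>
          simp only [Finset.mem_Iic, Fin.le_def, Fin.ext_iff] at hj ⊢
        · omega
        · omega
        · omega
        · omega
        · congr 1
          exact Fin.ext (by simp; omega)
      have h2 := (hx ⟨k, by omega⟩ hk).2
      rw [h1, ih k (Nat.lt_succ_self k)] at h2
      rw [shootVal_succ]
      exact h2

lemma IsBalanced.isGroundState {n : ℕ} {a : ℝ} (ha : IsBalanced n a) :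
    IsGroundState fun i : Fin (2 * n + 2) => shootVal a i where
  recursion := by
    intro i hi
    have h := sum_Iic_eq_shootSum (N := 2 * n + 2) (x := fun i => shootVal a i) (a := a)
      (fun k hk => rfl) i i.2
    rw [Fin.eta] at h
    rw [h]
    exact ⟨(ha.shootSum_pos (by omega)).ne', shootVal_succ a i⟩
  symmetric := by
    intro i
    rw [ha.symm (k := i) (by omega), Fin.val_rev]
    congr 2
    omega
  strictAnti := fun i j hij => ha.shootVal_lt hij (by omega)

/-- In the first half `x_k` exceeds its mirror image `-x_k`, hence is positive. -/
lemma IsGroundState.isBalanced {n : ℕ} {x : Fin (2 * n + 2) → ℝ} (hx : IsGroundState x) :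
    IsBalanced n (x 0) := by
  have hv := hx.recursion.eq_shootVal (by omega)
  refine ⟨fun k hk => ?_, ?_⟩
  · have h1 := hx.symmetric ⟨k, by omega⟩
    have h2 : x (Fin.rev ⟨k, by omega⟩) < x ⟨k, by omega⟩ := hx.strictAnti (by
      rw [Fin.lt_def, Fin.val_rev]
      simp only
      omega)
    have h3 := hv k (by omega)
    change 0 < shootVal (x ⟨0, _⟩) k
    rw [← h3]
    linarith
  · have h1 := hx.symmetric ⟨n, by omega⟩
    have h2 : Fin.rev (⟨n, by omega⟩ : Fin (2 * n + 2)) = ⟨n + 1, by omega⟩ :=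
      Fin.ext (by rw [Fin.val_rev]; simp only; omega)
    rw [h2, hv n (by omega), hv (n + 1) (by omega)] at h1
    change shootVal (x ⟨0, _⟩) n + shootVal (x ⟨0, _⟩) (n + 1) = 0
    linarith

lemma IsGroundState.eq_shootVal {n : ℕ} {x : Fin (2 * n + 2) → ℝ} (hx : IsGroundState x) :
    x = fun i : Fin (2 * n + 2) => shootVal (x 0) i :=
  funext fun i => hx.recursion.eq_shootVal (by omega) i i.2

theorem existsUnique_isGroundState (n : ℕ) : ∃! x : Fin (2 * n + 2) → ℝ, IsGroundState x := by
  obtain ⟨a, ha⟩ := exists_isBalanced n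
  refine ⟨_, ha.isGroundState, fun x hx => ?_⟩
  rw [hx.eq_shootVal, hx.isBalanced.unique ha]

/-! ### Upper bound by Stein's method -/

lemma integrable_empiricalDist {N : ℕ} (hN : N ≠ 0) (x : Fin N → ℝ) (h : ℝ → ℝ) :
    Integrable h (empiricalDist x) := by
  unfold empiricalDist
  refine Integrable.smul_measure ?_ (by simpa using hN)
  rw [integrable_finsetSum_measure]
  exact fun i _ => integrable_dirac (by simp)

lemma integral_empiricalDist {N : ℕ} (x : Fin N → ℝ) (h : ℝ → ℝ) :
    ∫ t, h t ∂(empiricalDist x) = (∑ i, h (x i)) / N := by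
  unfold empiricalDist
  rw [integral_smul_measure, integral_finsetSum_measure fun i _ => integrable_dirac (by simp)]
  simp [div_eq_inv_mul]

namespace IsBalanced

variable {n : ℕ} {a : ℝ}

lemma integral_empiricalDist_eq (h : ℝ → ℝ) :
    ∫ t, h t ∂(empiricalDist fun i : Fin (2 * n + 2) => shootVal a i) =
      (∑ k ∈ Finset.range (2 * n + 2), h (shootVal a k)) / ((2 * n + 2 : ℕ) : ℝ) := by
  rw [integral_empiricalDist, Finset.sum_range]

/-- Stein's method for the points of the recursion. -/
lemma abs_sum_sub_le (ha : IsBalanced n a) {h : ℝ → ℝ} (hh : LipschitzWith 1 h) :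
    |∑ k ∈ Finset.range (2 * n + 2), (h (shootVal a k) - ∫ s, h s ∂(gaussianReal 0 1))| ≤
      1 + 4 * a := by
  -- There is one more point than gaps: each gap is paired with the derivative at its lower end,
  -- leaving the derivative at `a`.
  have h1 : ∑ k ∈ Finset.range (2 * n + 2),
      (h (shootVal a k) - ∫ s, h s ∂(gaussianReal 0 1)) = steinDeriv h a -
        ∑ k ∈ Finset.range (2 * n + 1),
          ((steinSolution h (shootVal a k) - steinSolution h (shootVal a (k + 1))) /
            (shootVal a k - shootVal a (k + 1)) - steinDeriv h (shootVal a (k + 1))) := by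
    have h2 : ∀ t, h t - ∫ s, h s ∂(gaussianReal 0 1) = steinDeriv h t - t * steinSolution h t :=
      fun t => by unfold steinDeriv; ring
    simp_rw [h2]
    rw [Finset.sum_sub_distrib, ha.sum_mul_eq, Finset.sum_range_succ', Finset.sum_sub_distrib,
      shootVal_zero]
    ring
  have h2 : |steinDeriv h a| ≤ 1 + 2 * a := by
    have h3 := abs_steinDeriv_sub_le hh a 0
    rw [sub_zero, abs_of_pos ha.start_pos] at h3
    have h4 := abs_add_le (steinDeriv h a - steinDeriv h 0) (steinDeriv h 0)
    rw [sub_add_cancel] at h4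
    linarith [abs_steinDeriv_zero_le hh]
  have h3 := Finset.abs_sum_le_sum_abs (fun k =>
    (steinSolution h (shootVal a k) - steinSolution h (shootVal a (k + 1))) /
      (shootVal a k - shootVal a (k + 1)) - steinDeriv h (shootVal a (k + 1)))
    (Finset.range (2 * n + 1))
  have h4 := h3.trans (Finset.sum_le_sum fun k hk => abs_steinSolution_slope_sub_le hh
    (ha.shootVal_lt (Nat.lt_succ_self k) (by rw [Finset.mem_range] at hk; omega)))
  rw [ha.sum_gap] at h4
  rw [h1]
  refine (abs_sub _ _).trans ?_
  linarith

theorem wassersteinDist_le (ha : IsBalanced n a) :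
    wassersteinDist (empiricalDist fun i : Fin (2 * n + 2) => shootVal a i) (gaussianReal 0 1) ≤
      ENNReal.ofReal ((1 + 4 * a) / ((2 * n + 2 : ℕ) : ℝ)) := by
  unfold wassersteinDist
  refine iSup_le fun h => iSup_le fun hh => iSup_le fun _ => iSup_le fun _ =>
    ENNReal.ofReal_le_ofReal ?_
  have hN : (0 : ℝ) < ((2 * n + 2 : ℕ) : ℝ) := by positivity
  have h1 := ha.abs_sum_sub_le hh
  rw [Finset.sum_sub_distrib, Finset.sum_const, Finset.card_range, nsmul_eq_mul] at h1
  rw [integral_empiricalDist_eq, div_sub' hN.ne', abs_div, abs_of_pos hN]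
  exact div_le_div_of_nonneg_right h1 hN.le

/-! ### Lower bound by an explicit test function -/

/-- The zero set of the function that separates the two measures. -/
def nodeSet (n : ℕ) (a : ℝ) : Set ℝ :=
  {t | (∃ k ≤ 2 * n + 1, t = shootVal a k) ∨ a ≤ |t|}

/-- The distance to the points of the recursion inside `[-a, a]`, and zero outside. -/
noncomputable def nodeDist (n : ℕ) (a : ℝ) (t : ℝ) : ℝ := Metric.infDist t (nodeSet n a)

/-- The primitive of `nodeDist` that vanishes at the origin. -/
noncomputable def nodePrim (n : ℕ) (a : ℝ) (t : ℝ) : ℝ := ∫ s in (0 : ℝ)..t, nodeDist n a s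

lemma nodeDist_lipschitz : LipschitzWith 1 (nodeDist n a) := Metric.lipschitz_infDist_pt _

lemma nodeDist_nonneg (t : ℝ) : 0 ≤ nodeDist n a t := Metric.infDist_nonneg

lemma nodeDist_of_le_abs {t : ℝ} (ht : a ≤ |t|) : nodeDist n a t = 0 :=
  Metric.infDist_zero_of_mem (Or.inr ht)

lemma shootVal_mem_nodeSet {k : ℕ} (hk : k ≤ 2 * n + 1) : shootVal a k ∈ nodeSet n a :=
  Or.inl ⟨k, hk, rfl⟩

lemma nodeDist_shootVal {k : ℕ} (hk : k ≤ 2 * n + 1) : nodeDist n a (shootVal a k) = 0 :=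
  Metric.infDist_zero_of_mem (shootVal_mem_nodeSet hk)

lemma hasDerivAt_nodePrim (t : ℝ) : HasDerivAt (nodePrim n a) (nodeDist n a t) t := by
  have hc : Continuous (nodeDist n a) := nodeDist_lipschitz.continuous
  exact intervalIntegral.integral_hasDerivAt_right (hc.intervalIntegrable _ _)
    hc.stronglyMeasurable.stronglyMeasurableAtFilter hc.continuousAt

lemma exists_mem_Icc (ha : IsBalanced n a) {t : ℝ} (ht : |t| < a) :
    ∃ k ≤ 2 * n, shootVal a (k + 1) ≤ t ∧ t ≤ shootVal a k := by
  rw [abs_lt] at ht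
  have hex : ∃ k, shootVal a (k + 1) ≤ t := ⟨2 * n, by rw [ha.shootVal_last]; exact ht.1.le⟩
  classical
  refine ⟨Nat.find hex, Nat.find_min' hex (by rw [ha.shootVal_last]; exact ht.1.le),
    Nat.find_spec hex, ?_⟩
  rcases h : Nat.find hex with _ | k
  · rw [shootVal_zero]
    exact ht.2.le
  · exact (not_le.1 (Nat.find_min hex (m := k) (by omega))).le

/-- All sums before the last are at least `a`, so no gap exceeds `1 / a`; the distance is at most
half a gap. -/
lemma nodeDist_le (ha : IsBalanced n a) (t : ℝ) : nodeDist n a t ≤ 1 / (2 * a) := by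
  have ha0 := ha.start_pos
  rcases le_or_gt a |t| with h | h
  · rw [nodeDist_of_le_abs h]
    positivity
  · obtain ⟨k, hk, h1, h2⟩ := ha.exists_mem_Icc h
    have h3 := Metric.infDist_le_dist_of_mem (x := t)
      (shootVal_mem_nodeSet (n := n) (a := a) (k := k) (by omega))
    have h4 := Metric.infDist_le_dist_of_mem (x := t)
      (shootVal_mem_nodeSet (n := n) (a := a) (k := k + 1) (by omega))
    rw [Real.dist_eq, abs_of_nonpos (by linarith)] at h3
    rw [Real.dist_eq, abs_of_nonneg (by linarith)] at h4
    have h5 : 1 / shootSum a k ≤ 1 / a :=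
      one_div_le_one_div_of_le ha0 (ha.start_le_shootSum hk)
    have h6 := gap (a := a) k
    have h7 : 1 / (2 * a) = 1 / a / 2 := by field_simp
    unfold nodeDist
    linarith

lemma abs_mul_nodeDist_le (ha : IsBalanced n a) (t : ℝ) : |t * nodeDist n a t| ≤ 1 / 2 := by
  have ha0 := ha.start_pos
  rcases le_or_gt a |t| with h | h
  · rw [nodeDist_of_le_abs h]
    norm_num
  · rw [abs_mul, abs_of_nonneg (nodeDist_nonneg t)]
    calc |t| * nodeDist n a t ≤ a * (1 / (2 * a)) :=
          mul_le_mul h.le (ha.nodeDist_le t) (nodeDist_nonneg t) ha0.le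
      _ = 1 / 2 := by field_simp

/-- Integrate the bound `1 / (2 a)` over a length of at most `a`; beyond `±a` the primitive is
constant. -/
lemma abs_nodePrim_le (ha : IsBalanced n a) (t : ℝ) : |nodePrim n a t| ≤ 1 / 2 := by
  have ha0 := ha.start_pos
  have hc : Continuous (nodeDist n a) := nodeDist_lipschitz.continuous
  have hsmall : ∀ s, |s| ≤ a → |nodePrim n a s| ≤ 1 / 2 := by
    intro s hs
    have h1 := intervalIntegral.norm_integral_le_of_norm_le_const (a := 0) (b := s)
      (f := nodeDist n a) (C := 1 / (2 * a)) fun u _ => by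
        rw [Real.norm_eq_abs, abs_of_nonneg (nodeDist_nonneg u)]
        exact ha.nodeDist_le u
    rw [sub_zero] at h1
    calc |nodePrim n a s| ≤ 1 / (2 * a) * |s| := h1
      _ ≤ 1 / (2 * a) * a := by gcongr
      _ = 1 / 2 := by field_simp
  have hzero : ∀ u v : ℝ, (∀ s ∈ uIcc u v, a ≤ |s|) → nodePrim n a v = nodePrim n a u := by
    intro u v huv
    have h1 : ∫ s in u..v, nodeDist n a s = 0 := by
      rw [intervalIntegral.integral_congr (g := fun _ => 0)
        fun s hs => nodeDist_of_le_abs (huv s hs)]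
      simp
    have h2 := intervalIntegral.integral_add_adjacent_intervals
      (hc.intervalIntegrable 0 u (μ := volume)) (hc.intervalIntegrable u v (μ := volume))
    unfold nodePrim
    linarith
  rcases le_or_gt |t| a with h | h
  · exact hsmall t h
  · rcases lt_abs.1 h with h | h
    · rw [hzero a t fun s hs => by
        rw [uIcc_of_le h.le] at hs
        exact hs.1.trans (le_abs_self s)]
      exact hsmall a (abs_of_pos ha0).le
    · rw [hzero (-a) t fun s hs => by
        rw [uIcc_of_ge (by linarith)] at hs
        exact le_trans (by linarith [hs.2]) (neg_le_abs s)]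
      exact hsmall (-a) (by rw [abs_neg, abs_of_pos ha0])

/-- The increments of `nodePrim` are of the order of the squared gaps. -/
lemma sq_gap_le (ha : IsBalanced n a) {k : ℕ} (hk : k ≤ 2 * n) :
    (shootVal a k - shootVal a (k + 1)) ^ 2 / 6 ≤
      nodePrim n a (shootVal a k) - nodePrim n a (shootVal a (k + 1)) := by
  have hlt := ha.shootVal_lt (Nat.lt_succ_self k) (by omega)
  set q := shootVal a k with hq
  set p := shootVal a (k + 1) with hp
  have hL : 0 < q - p := sub_pos.2 hlt
  -- For `u, v > 0` one has `u v / (u + v) ≤ min u v`. This parabola has integral `(q - p)² / 6`,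
  -- which avoids integrating a piecewise function.
  have hlow : ∀ t ∈ Ioo p q, (t - p) * (q - t) / (q - p) ≤ nodeDist n a t := by
    intro t ht
    have hne : (nodeSet n a).Nonempty := ⟨_, shootVal_mem_nodeSet (k := k) (by omega)⟩
    rw [nodeDist, Metric.le_infDist hne]
    intro s hs
    have hs' : s ≤ p ∨ q ≤ s := by
      rcases hs with ⟨j, hj, rfl⟩ | hs
      · rcases Nat.lt_or_ge k j with h | h
        · exact Or.inl (ha.shootVal_le h hj)
        · exact Or.inr (ha.shootVal_le h (by omega))
      · have h1 := ha.shootVal_le (i := 0) (j := k) (by omega) (by omega)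
        have h2 := ha.shootVal_le (i := k + 1) (j := 2 * n + 1) (by omega) (by omega)
        rw [shootVal_zero] at h1
        rw [ha.shootVal_last] at h2
        rcases le_abs.1 hs with h | h
        · exact Or.inr (h1.trans h)
        · exact Or.inl (by linarith)
    have hu : 0 < t - p := sub_pos.2 ht.1
    have hv : 0 < q - t := sub_pos.2 ht.2
    rw [div_le_iff₀ hL, Real.dist_eq]
    rcases hs' with h | h
    · have : t - p ≤ |t - s| := le_trans (by linarith) (le_abs_self _)
      nlinarith
    · have : q - t ≤ |t - s| := le_trans (by linarith) (neg_le_abs _)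
      nlinarith
  have hd : ∀ t, HasDerivAt
      (fun t => nodePrim n a t - ((t - p) ^ 2 / 2 - (t - p) ^ 3 / (3 * (q - p))))
      (nodeDist n a t - (t - p) * (q - t) / (q - p)) t := by
    intro t
    refine ((hasDerivAt_nodePrim t).fun_sub
      (((((hasDerivAt_id' t).sub_const p).fun_pow 2).div_const 2).fun_sub
        ((((hasDerivAt_id' t).sub_const p).fun_pow 3).div_const (3 * (q - p))))).congr_deriv ?_
    field_simp
    ring
  obtain ⟨s, hs, hs'⟩ := exists_hasDerivAt_eq_slope _ _ hlt
    (fun t _ => (hd t).continuousAt.continuousWithinAt) (fun t _ => hd t)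
  have h1 := hlow s hs
  rw [eq_div_iff hL.ne'] at hs'
  have h2 : 0 ≤ (nodeDist n a s - (s - p) * (q - s) / (q - p)) * (q - p) :=
    mul_nonneg (by linarith) hL.le
  have h3 : (q - p) ^ 2 / 2 - (q - p) ^ 3 / (3 * (q - p)) = (q - p) ^ 2 / 6 := by
    field_simp
    ring
  rw [hs', h3] at h2
  simp only [sub_self] at h2
  norm_num at h2
  linarith

/-- The test function for the lower bound. -/
noncomputable def testFun (n : ℕ) (a : ℝ) (t : ℝ) : ℝ :=
  (nodeDist n a t - t * nodePrim n a t) / 2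

/-- Both `d` and `t P` are 1-Lipschitz, the latter as `|P| ≤ 1/2` and `|t d| ≤ 1/2`; hence the
division by 2. -/
lemma lipschitzWith_testFun (ha : IsBalanced n a) : LipschitzWith 1 (testFun n a) := by
  have h1 : LipschitzWith 1 fun t => t * nodePrim n a t := by
    have hd : ∀ t, HasDerivAt (fun t => t * nodePrim n a t)
        (1 * nodePrim n a t + t * nodeDist n a t) t :=
      fun t => (hasDerivAt_id' t).fun_mul (hasDerivAt_nodePrim t)
    refine lipschitzWith_of_nnnorm_deriv_le (fun t => (hd t).differentiableAt) fun t => ?_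
    rw [(hd t).deriv, ← NNReal.coe_le_coe, coe_nnnorm, Real.norm_eq_abs, one_mul]
    refine (abs_add_le _ _).trans ?_
    have h2 := ha.abs_nodePrim_le t
    have h3 := ha.abs_mul_nodeDist_le t
    rw [NNReal.coe_one]
    linarith
  refine LipschitzWith.of_dist_le_mul fun s t => ?_
  have h2 := h1.dist_le_mul s t
  have h3 := (nodeDist_lipschitz (n := n) (a := a)).dist_le_mul s t
  simp only [Real.dist_eq, NNReal.coe_one, one_mul] at *
  have h4 : testFun n a s - testFun n a t = ((nodeDist n a s - nodeDist n a t) -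
      (s * nodePrim n a s - t * nodePrim n a t)) / 2 := by
    unfold testFun
    ring
  rw [h4, abs_div, abs_two]
  have h5 := abs_sub (nodeDist n a s - nodeDist n a t) (s * nodePrim n a s - t * nodePrim n a t)
  linarith

/-- The test function times `φ` is the derivative of `P φ / 2`, because `φ' = -t φ`. -/
lemma integral_testFun_gaussianReal (ha : IsBalanced n a) :
    ∫ t, testFun n a t ∂(gaussianReal 0 1) = 0 := by
  have hi := integrable_mul_gaussianPDFReal ha.lipschitzWith_testFun.integrable_gaussianReal
  have hpl : LipschitzWith (Real.toNNReal (1 / (2 * a))) (nodePrim n a) :=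
    lipschitzWith_of_nnnorm_deriv_le (fun t => (hasDerivAt_nodePrim t).differentiableAt)
      fun t => by
        rw [(hasDerivAt_nodePrim t).deriv, ← NNReal.coe_le_coe, coe_nnnorm, Real.norm_eq_abs,
          abs_of_nonneg (nodeDist_nonneg t)]
        exact (ha.nodeDist_le t).trans (Real.le_coe_toNNReal _)
  have hp := (integrable_mul_gaussianPDFReal hpl.integrable_gaussianReal).div_const 2
  rw [integral_gaussianReal_eq_integral_mul]
  refine integral_eq_zero_of_hasDerivAt_of_integrable (fun t => ?_) hi hp
  refine (((hasDerivAt_nodePrim t).fun_mul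
    (hasDerivAt_gaussianPDFReal_zero_one t)).div_const 2).congr_deriv ?_
  unfold testFun
  ring

/-- Only `-x P(x) / 2` survives on the points. Summation by parts and `sq_gap_le` bound `∑ x P(x)`
below by the sum of gap / 6, which is `a / 3`. -/
lemma sum_testFun_le (ha : IsBalanced n a) :
    ∑ k ∈ Finset.range (2 * n + 2), testFun n a (shootVal a k) ≤ -(a / 6) := by
  have h1 : ∑ k ∈ Finset.range (2 * n + 2), testFun n a (shootVal a k) =
      -(∑ k ∈ Finset.range (2 * n + 2), shootVal a k * nodePrim n a (shootVal a k)) / 2 := by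
    rw [← Finset.sum_neg_distrib, Finset.sum_div]
    refine Finset.sum_congr rfl fun k hk => ?_
    rw [Finset.mem_range] at hk
    rw [testFun, nodeDist_shootVal (by omega), zero_sub]
  have h2 : ∑ k ∈ Finset.range (2 * n + 1), (shootVal a k - shootVal a (k + 1)) / 6 ≤
      ∑ k ∈ Finset.range (2 * n + 2), shootVal a k * nodePrim n a (shootVal a k) := by
    rw [ha.sum_mul_eq]
    refine Finset.sum_le_sum fun k hk => ?_
    rw [Finset.mem_range] at hk
    have hpos := sub_pos.2 (ha.shootVal_lt (Nat.lt_succ_self k) (by omega))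
    rw [le_div_iff₀ hpos]
    exact le_trans (le_of_eq (by ring)) (ha.sq_gap_le (k := k) (by omega))
  rw [← Finset.sum_div, ha.sum_gap] at h2
  rw [h1]
  linarith

theorem le_wassersteinDist (ha : IsBalanced n a) :
    ENNReal.ofReal (a / 6 / ((2 * n + 2 : ℕ) : ℝ)) ≤
      wassersteinDist (empiricalDist fun i : Fin (2 * n + 2) => shootVal a i)
        (gaussianReal 0 1) := by
  have hl := ha.lipschitzWith_testFun
  refine le_trans (ENNReal.ofReal_le_ofReal ?_)
    (le_iSup₂_of_le (testFun n a) hl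
      (le_iSup₂_of_le (integrable_empiricalDist (by omega) _ _) hl.integrable_gaussianReal le_rfl))
  have hN : (0 : ℝ) < ((2 * n + 2 : ℕ) : ℝ) := by positivity
  rw [integral_empiricalDist_eq, ha.integral_testFun_gaussianReal, sub_zero, abs_div,
    abs_of_pos hN]
  refine div_le_div_of_nonneg_right ?_ hN.le
  rw [le_abs]
  exact Or.inr (by linarith [ha.sum_testFun_le])

end IsBalanced

/-! ### Assembly of the theorem -/

theorem mainTheorem3 :
    -- existence and uniqueness of the symmetric, monotone solution
    (∀ N : ℕ, 2 ≤ N → Even N → ∃! x : Fin N → ℝ, IsGroundState x) ∧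
    -- the distance to the standard Gaussian is of exact order `√(log N) / N`
    (∃ c C : ℝ, 0 < c ∧ 0 < C ∧
      ∀ N : ℕ, 2 ≤ N → Even N → ∀ x : Fin N → ℝ, IsGroundState x →
        ENNReal.ofReal (c * (Real.sqrt (Real.log N) / N)) ≤
            wassersteinDist (empiricalDist x) (gaussianReal 0 1) ∧
          wassersteinDist (empiricalDist x) (gaussianReal 0 1) ≤
            ENNReal.ofReal (C * (Real.sqrt (Real.log N) / N))) ∧
    -- the explicit upper bound `(1 + 4 x_1) / N`
    (∀ (N : ℕ) (hN : 2 ≤ N), Even N → ∀ x : Fin N → ℝ, IsGroundState x →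
      wassersteinDist (empiricalDist x) (gaussianReal 0 1) ≤
        ENNReal.ofReal ((1 + 4 * x ⟨0, by omega⟩) / N)) ∧
    -- `x_1 = O(√(log N))`
    (∃ A : ℝ, 0 < A ∧
      ∀ (N : ℕ) (hN : 2 ≤ N), Even N → ∀ x : Fin N → ℝ, IsGroundState x →
        x ⟨0, by omega⟩ ≤ A * Real.sqrt (Real.log N)) := by
  have hform : ∀ N : ℕ, 2 ≤ N → Even N → ∃ n, N = 2 * n + 2 := by
    rintro N hN ⟨m, rfl⟩
    exact ⟨m - 1, by omega⟩
  -- `1 / 12` combines `a / 6` with `√(log N) ≤ 2 a`. For 14: `4 a ≤ 12 √(log N)` and `1 ≤ 2 √(log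
  -- N)`.
  refine ⟨fun N hN hE => ?_, ⟨1 / 12, 14, by norm_num, by norm_num, fun N hN hE x hx => ?_⟩,
    fun N hN hE x hx => ?_, ⟨3, by norm_num, fun N hN hE x hx => ?_⟩⟩ <;>
    obtain ⟨n, rfl⟩ := hform N hN hE
  · exact existsUnique_isGroundState n
  · have ha := hx.isBalanced
    have hN0 : (0 : ℝ) < ((2 * n + 2 : ℕ) : ℝ) := by positivity
    rw [hx.eq_shootVal]
    constructor
    · refine le_trans (ENNReal.ofReal_le_ofReal ?_) ha.le_wassersteinDist
      rw [← mul_div_assoc]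
      refine div_le_div_of_nonneg_right ?_ hN0.le
      linarith [ha.sqrt_log_le_start]
    · refine ha.wassersteinDist_le.trans (ENNReal.ofReal_le_ofReal ?_)
      rw [← mul_div_assoc]
      refine div_le_div_of_nonneg_right ?_ hN0.le
      have h1 := ha.start_le_sqrt_log
      have h2 : 1 / 2 ≤ √(Real.log ((2 * n + 2 : ℕ) : ℝ)) := by
        refine Real.le_sqrt_of_sq_le ?_
        have h3 : Real.log 2 ≤ Real.log ((2 * n + 2 : ℕ) : ℝ) :=
          Real.log_le_log (by norm_num) (by push_cast; linarith [(n.cast_nonneg : (0 : ℝ) ≤ n)])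
        linarith [Real.log_two_gt_d9]
      linarith
  · rw [hx.eq_shootVal]
    exact hx.isBalanced.wassersteinDist_le
  · exact hx.isBalanced.start_le_sqrt_log
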